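/- Call a subset of a topological space $X$ $\sigma$-discrete if it is the union of countably many sets each of which is discrete in $X$ (closed in $X$ and discrete in its subspace topology). A space $X$ is a $\Lambda$-set if every $\sigma$-discrete subset of $X$ is a $G_\delta$-set in $X$; it is $h$-homogeneous if $\mathrm{Ind}\,X=0$ and every non-empty clopen subset of $X$ is homeomorphic to $X$; and it is densely homogeneous if (1) $X$ has a $\sigma$-discrete dense subset and (2) for any two $\sigma$-discrete dense subsets $A$ and $B$ of $X$ there is a homeomorphism $f\colon X\to X$ with $f(A)=B$. Theorem. Let $X$ be an $h$-homogeneous metrizable $\Lambda$-set which is not a $\sigma$-discrete space without isolated points. Then $X$ is densely homogeneous. -/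

import Mathlib

open Set Topology

/-- A subset `A` of a space is `σ`-discrete if it is the union of countably many sets each of
which is discrete in the whole space, that is, closed and with discrete subspace topology. -/
def IsSigmaDiscrete {X : Type*} [TopologicalSpace X] (A : Set X) : Prop :=
  ∃ D : ℕ → Set X, (∀ n, IsClosed (D n) ∧ IsDiscrete (D n)) ∧ A = ⋃ n, D n

/-- A `Λ`-set is a space in which every `σ`-discrete subset is a `G_δ`-set. -/
def IsLambdaSet (X : Type*) [TopologicalSpace X] : Prop :=
  ∀ A : Set X, IsSigmaDiscrete A → IsGδ A

/-- `Ind X = 0`: the space is non-empty (`Ind X > -1`), and between every closed set and every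
open set containing it there is an open set with empty boundary, i.e. a clopen set
(`Ind X ≤ 0`). -/
def LargeIndEqZero (X : Type*) [TopologicalSpace X] : Prop :=
  Nonempty X ∧ ∀ F U : Set X, IsClosed F → IsOpen U → F ⊆ U →
    ∃ C : Set X, IsClopen C ∧ F ⊆ C ∧ C ⊆ U

/-- A space `X` is `h`-homogeneous if `Ind X = 0` and every non-empty clopen subset of `X` is
homeomorphic to `X`. -/
def IsHHomogeneous (X : Type*) [TopologicalSpace X] : Prop :=
  LargeIndEqZero X ∧ ∀ C : Set X, IsClopen C → C.Nonempty → Nonempty (C ≃ₜ X)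

/-- A space `X` is densely homogeneous if it has a `σ`-discrete dense subset and any two
`σ`-discrete dense subsets are mapped onto each other by a homeomorphism of `X`. -/
def IsDenselyHomogeneous (X : Type*) [TopologicalSpace X] : Prop :=
  (∃ A : Set X, IsSigmaDiscrete A ∧ Dense A) ∧
    ∀ A B : Set X, IsSigmaDiscrete A → Dense A → IsSigmaDiscrete B → Dense B →
      ∃ f : X ≃ₜ X, f '' A = B

open Filter (codiscrete)

/-! Fix a compatible metric. If some point is isolated, `h`-homogeneity makes `X` a single point.
Otherwise `X` is not `σ`-discrete, so complements of `σ`-discrete sets are dense, and `A`, `Aᶜ`,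
`B`, `Bᶜ` are all dense. Any point can be moved into any of them inside an arbitrarily small clopen
set (`exists_homeomorph_clopen_apply_mem`).

Closing off under countably many such moves gives a `σ`-discrete `S ⊇ A ∪ B` invariant under a
family that still moves points of `S` locally into all four sets
(`exists_invariant_isSigmaDiscrete`). By the `Λ`-property `S` is a `G_δ`, so `Sᶜ` is an increasing
union of closed sets. A back-and-forth along the discrete pieces of `S` matches `A` with `B`, while
ever larger closed parts of `Sᶜ` are frozen. Every point is thus eventually stationary, so the limit
is a bijection without any completeness (`exists_homeomorph_image_eq_of_locallyMovesInto`). -/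

/-! ### Closed discrete and `σ`-discrete sets -/

theorem compl_mem_codiscrete_of_subset {X : Type*} [TopologicalSpace X] {D E : Set X}
    (hE : Eᶜ ∈ codiscrete X) (h : D ⊆ E) : Dᶜ ∈ codiscrete X :=
  Filter.mem_of_superset hE (compl_subset_compl.2 h)

theorem compl_union_mem_codiscrete {X : Type*} [TopologicalSpace X] {D E : Set X}
    (hD : Dᶜ ∈ codiscrete X) (hE : Eᶜ ∈ codiscrete X) : (D ∪ E)ᶜ ∈ codiscrete X := by
  rw [compl_union]
  exact Filter.inter_mem hD hE

theorem Homeomorph.compl_image_mem_codiscrete {X Y : Type*} [TopologicalSpace X]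
    [TopologicalSpace Y] (f : X ≃ₜ Y) {D : Set X} (hD : Dᶜ ∈ codiscrete X) :
    (f '' D)ᶜ ∈ codiscrete Y := by
  rw [compl_mem_codiscrete_iff] at hD ⊢
  exact ⟨f.isClosedMap _ hD.1, hD.2.image f.isInducing⟩

/-- In terms of the filter `codiscrete X`, subsets and finite unions of closed discrete sets come
from the filter axioms. -/
theorem isSigmaDiscrete_iff {X : Type*} [TopologicalSpace X] {A : Set X} :
    IsSigmaDiscrete A ↔ ∃ D : ℕ → Set X, (∀ n, (D n)ᶜ ∈ codiscrete X) ∧ A = ⋃ n, D n := by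
  simp only [IsSigmaDiscrete, compl_mem_codiscrete_iff]

theorem isSigmaDiscrete_empty {X : Type*} [TopologicalSpace X] :
    IsSigmaDiscrete (∅ : Set X) :=
  isSigmaDiscrete_iff.2 ⟨fun _ => ∅, by simp, by simp⟩

theorem IsSigmaDiscrete.iUnion {X : Type*} [TopologicalSpace X] {A : ℕ → Set X}
    (hA : ∀ n, IsSigmaDiscrete (A n)) : IsSigmaDiscrete (⋃ n, A n) := by
  simp only [isSigmaDiscrete_iff] at hA ⊢
  choose D hD hAD using hA
  refine ⟨fun k => D k.unpair.1 k.unpair.2, fun k => hD _ _, ?_⟩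
  ext x
  simp only [hAD, mem_iUnion]
  refine ⟨fun ⟨n, m, h⟩ => ⟨Nat.pair n m, by simpa using h⟩, fun ⟨k, h⟩ => ⟨_, _, h⟩⟩

theorem IsSigmaDiscrete.biUnion {X ι : Type*} [TopologicalSpace X] {s : Set ι}
    (hs : s.Countable) {A : ι → Set X} (hA : ∀ i ∈ s, IsSigmaDiscrete (A i)) :
    IsSigmaDiscrete (⋃ i ∈ s, A i) := by
  rcases s.eq_empty_or_nonempty with rfl | hne
  · simpa using isSigmaDiscrete_empty
  · obtain ⟨e, rfl⟩ := hs.exists_eq_range hne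
    rw [biUnion_range]
    exact .iUnion fun n => hA _ (mem_range_self n)

theorem IsSigmaDiscrete.union {X : Type*} [TopologicalSpace X] {A B : Set X}
    (hA : IsSigmaDiscrete A) (hB : IsSigmaDiscrete B) : IsSigmaDiscrete (A ∪ B) := by
  rw [union_eq_iUnion]
  have := IsSigmaDiscrete.biUnion (s := (univ : Set Bool)) (to_countable _)
    (A := fun b => cond b A B) (by rintro (_ | _) - <;> assumption)
  simpa only [mem_univ, iUnion_true] using this

theorem IsSigmaDiscrete.image {X Y : Type*} [TopologicalSpace X] [TopologicalSpace Y]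
    {A : Set X} (hA : IsSigmaDiscrete A) (f : X ≃ₜ Y) : IsSigmaDiscrete (f '' A) := by
  rw [isSigmaDiscrete_iff] at hA ⊢
  obtain ⟨D, hD, rfl⟩ := hA
  exact ⟨fun n => f '' D n, fun n => f.compl_image_mem_codiscrete (hD n), image_iUnion⟩

theorem compl_mem_codiscrete_of_separated {X : Type*} [MetricSpace X] {D : Set X} {ε : ℝ}
    (hε : 0 < ε) (hD : ∀ x ∈ D, ∀ y ∈ D, x ≠ y → ε ≤ dist x y) : Dᶜ ∈ codiscrete X := by
  rw [mem_codiscrete]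
  intro x
  rw [compl_compl, Filter.disjoint_principal_right]
  by_cases h : ∃ y ∈ D, y ≠ x ∧ dist y x < ε / 2
  · obtain ⟨y, hy, hyx, hd⟩ := h
    filter_upwards [nhdsWithin_le_nhds (Metric.ball_mem_nhds x (dist_pos.2 hyx)),
      nhdsWithin_le_nhds (Metric.ball_mem_nhds x (half_pos hε))] with z hz hz' hzD
    rw [Metric.mem_ball] at hz hz'
    have := hD z hzD y hy (by rintro rfl; exact lt_irrefl _ hz)
    linarith [dist_triangle_right z y x]
  · push Not at h
    filter_upwards [nhdsWithin_le_nhds (Metric.ball_mem_nhds x (half_pos hε)),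
      self_mem_nhdsWithin] with z hz hzx hzD
    exact absurd hz (not_lt.2 (h z hzD hzx))

/-- A maximal `1 / (n + 1)`-separated set is closed, discrete and a `1 / (n + 1)`-net; take the
union over `n`. -/
theorem exists_isSigmaDiscrete_dense (X : Type*) [MetricSpace X] :
    ∃ A : Set X, IsSigmaDiscrete A ∧ Dense A := by
  have key : ∀ n : ℕ, ∃ D : Set X, Dᶜ ∈ codiscrete X ∧
      ∀ x, ∃ y ∈ D, dist x y < 1 / (n + 1 : ℝ) := by
    intro n
    have hε : (0 : ℝ) < 1 / (n + 1 : ℝ) := Nat.one_div_pos_of_nat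
    obtain ⟨D, hD⟩ := zorn_subset
      {N : Set X | ∀ x ∈ N, ∀ y ∈ N, x ≠ y → 1 / (n + 1 : ℝ) ≤ dist x y} (by
        intro c hc hch
        refine ⟨⋃₀ c, ?_, fun s hs => subset_sUnion_of_mem hs⟩
        rintro x ⟨s, hs, hx⟩ y ⟨t, ht, hy⟩ hxy
        rcases hch.total hs ht with h | h
        · exact hc ht x (h hx) y hy hxy
        · exact hc hs x hx y (h hy) hxy)
    refine ⟨D, compl_mem_codiscrete_of_separated hε hD.prop, fun x => ?_⟩
    by_contra! hx
    have hins : insert x D ∈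
        {N : Set X | ∀ x ∈ N, ∀ y ∈ N, x ≠ y → 1 / (n + 1 : ℝ) ≤ dist x y} := by
      rintro y (rfl | hy) z (rfl | hz) hyz
      · exact absurd rfl hyz
      · exact hx z hz
      · rw [dist_comm]; exact hx y hy
      · exact hD.prop y hy z hz hyz
    have := hx x (hD.le_of_ge hins (subset_insert x D) (mem_insert x D))
    rw [dist_self] at this
    linarith
  choose D hD hdense using key
  refine ⟨⋃ n, D n, isSigmaDiscrete_iff.2 ⟨D, hD, rfl⟩, ?_⟩
  rw [Metric.dense_iff]
  intro x r hr
  obtain ⟨n, hn⟩ := exists_nat_one_div_lt hr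
  obtain ⟨y, hy, hxy⟩ := hdense n x
  exact ⟨y, by rw [Metric.mem_ball, dist_comm]; linarith, mem_iUnion.2 ⟨n, hy⟩⟩

/-! ### Gluing and limits of homeomorphisms -/

theorem exists_discrete_open_family {X : Type*} [MetricSpace X] {D : Set X}
    (hD : Dᶜ ∈ codiscrete X) (U : X → Set X) (hU : ∀ a ∈ D, U a ∈ 𝓝 a) :
    ∃ W : X → Set X, (∀ a ∈ D, IsOpen (W a) ∧ a ∈ W a ∧ W a ⊆ U a) ∧
      ∀ x, ∃ N ∈ 𝓝 x, ∀ a ∈ D, ∀ b ∈ D, (W a ∩ N).Nonempty → (W b ∩ N).Nonempty → a = b := by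
  have hball : ∀ x, ∃ r > 0, ∀ y ∈ D, dist y x < r → y = x := by
    intro x
    have h := mem_codiscrete.1 hD x
    rw [compl_compl, Filter.disjoint_principal_right, mem_nhdsWithin_iff_exists_mem_nhds_inter] at h
    obtain ⟨u, hu, hsub⟩ := h
    obtain ⟨r, hr, hru⟩ := Metric.mem_nhds_iff.1 hu
    refine ⟨r, hr, fun y hy hyx => ?_⟩
    by_contra hne
    exact hsub ⟨hru hyx, hne⟩ hy
  have hr : ∀ a : X, ∃ r > 0, (a ∈ D → Metric.ball a r ⊆ U a) ∧ ∀ y ∈ D, dist y a < r → y = a := by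
    intro a
    obtain ⟨r, hr, h⟩ := hball a
    by_cases ha : a ∈ D
    · obtain ⟨s, hs, hsU⟩ := Metric.mem_nhds_iff.1 (hU a ha)
      exact ⟨min r s, lt_min hr hs, fun _ => (Metric.ball_subset_ball (min_le_right _ _)).trans hsU,
        fun y hy hya => h y hy (hya.trans_le (min_le_left _ _))⟩
    · exact ⟨r, hr, fun h => absurd h ha, h⟩
  choose r hr0 hrU hrD using hr
  refine ⟨fun a => Metric.ball a (r a / 4), fun a ha => ⟨Metric.isOpen_ball,
    Metric.mem_ball_self (by linarith [hr0 a]),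
    (Metric.ball_subset_ball (by linarith [hr0 a])).trans (hrU a ha)⟩, fun x => ?_⟩
  refine ⟨Metric.ball x (r x / 2), Metric.ball_mem_nhds x (half_pos (hr0 x)), ?_⟩
  -- If `a ≠ b`, then `r a ≤ dist b a < r a / 2 + r x`, so `r a < 2 * r x`. Both points then lie
  -- within `r x` of `x`, which forces both to equal `x`.
  have main : ∀ a ∈ D, ∀ b ∈ D, r b ≤ r a →
      (Metric.ball a (r a / 4) ∩ Metric.ball x (r x / 2)).Nonempty →
      (Metric.ball b (r b / 4) ∩ Metric.ball x (r x / 2)).Nonempty → a = b := by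
    rintro a ha b hb hab ⟨y, hya, hyx⟩ ⟨z, hzb, hzx⟩
    rw [Metric.mem_ball] at *
    by_contra hne
    have h1 : r a ≤ dist b a := not_lt.1 fun h => hne (hrD a b hb h).symm
    have d1 := dist_triangle_left a x y
    have d2 := dist_triangle_left b x z
    have d3 := dist_triangle_right b a x
    have hax : a = x := hrD x a ha (by linarith)
    have hbx : b = x := hrD x b hb (by linarith)
    exact hne (hax.trans hbx.symm)
  intro a ha b hb h1 h2
  rcases le_total (r b) (r a) with h | h
  · exact main a ha b hb h h1 h2
  · exact (main b hb a ha h h2 h1).symm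

theorem continuous_of_discrete_clopen_family {X : Type*} [TopologicalSpace X] {D : Set X}
    {V : X → Set X} (hV : ∀ a ∈ D, IsClopen (V a))
    (hN : ∀ x, ∃ N ∈ 𝓝 x, ∀ a ∈ D, ∀ b ∈ D, (V a ∩ N).Nonempty → (V b ∩ N).Nonempty → a = b)
    {g : X → X → X} (hg : ∀ a ∈ D, Continuous (g a)) {G : X → X}
    (hG : ∀ a ∈ D, ∀ x ∈ V a, G x = g a x) (hG' : ∀ x, (∀ a ∈ D, x ∉ V a) → G x = x) :
    Continuous G := by
  rw [continuous_iff_continuousAt]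
  intro x
  by_cases hx : ∃ a ∈ D, x ∈ V a
  · obtain ⟨a, ha, hxa⟩ := hx
    refine (hg a ha).continuousAt.congr ?_
    filter_upwards [(hV a ha).isOpen.mem_nhds hxa] with y hy using (hG a ha y hy).symm
  · push Not at hx
    refine continuousAt_id.congr ?_
    obtain ⟨N, hNx, hN⟩ := hN x
    by_cases h : ∃ a ∈ D, (V a ∩ N).Nonempty
    · obtain ⟨a, ha, hne⟩ := h
      filter_upwards [hNx, (hV a ha).compl.isOpen.mem_nhds (hx a ha)] with y hyN hya
      refine (hG' y fun b hb hyb => hya ?_).symm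
      rwa [hN a ha b hb hne ⟨y, hyb, hyN⟩]
    · filter_upwards [hNx] with y hyN
      exact (hG' y fun b hb hyb => h ⟨b, hb, y, hyb, hyN⟩).symm

/-- The invariant clopen sets can be shrunk into a discrete family, so the local homeomorphisms act
independently, with the identity elsewhere. -/
theorem exists_homeomorph_glue {X : Type*} [MetricSpace X] {D : Set X}
    (hD : Dᶜ ∈ codiscrete X) (U : X → Set X) (hU : ∀ a ∈ D, U a ∈ 𝓝 a)
    (p : X → (X ≃ₜ X) → Prop)
    (hp : ∀ a ∈ D, ∀ O, IsOpen O → a ∈ O → ∃ (g : X ≃ₜ X) (V : Set X), IsClopen V ∧ a ∈ V ∧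
      V ⊆ O ∧ (∀ x, g x ∈ V ↔ x ∈ V) ∧ p a g) :
    ∃ (G : X ≃ₜ X) (V : X → Set X) (g : X → (X ≃ₜ X)),
      (∀ a ∈ D, IsClopen (V a) ∧ a ∈ V a ∧ V a ⊆ U a ∧ (∀ x, g a x ∈ V a ↔ x ∈ V a) ∧ p a (g a) ∧
        ∀ x ∈ V a, G x = g a x) ∧ ∀ x, (∀ a ∈ D, x ∉ V a) → G x = x := by
  obtain ⟨W, hW, hN⟩ := exists_discrete_open_family hD U hU
  have hp' : ∀ a, ∃ (g : X ≃ₜ X) (V : Set X), a ∈ D → IsClopen V ∧ a ∈ V ∧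
      V ⊆ W a ∧ (∀ x, g x ∈ V ↔ x ∈ V) ∧ p a g := by
    intro a
    by_cases ha : a ∈ D
    · obtain ⟨g, V, h⟩ := hp a ha (W a) (hW a ha).1 (hW a ha).2.1
      exact ⟨g, V, fun _ => h⟩
    · exact ⟨.refl X, ∅, fun h => absurd h ha⟩
  choose g V hgV using hp'
  have hN' : ∀ x, ∃ N ∈ 𝓝 x, ∀ a ∈ D, ∀ b ∈ D, (V a ∩ N).Nonempty → (V b ∩ N).Nonempty →
      a = b := by
    intro x
    obtain ⟨N, hNx, hN⟩ := hN x
    exact ⟨N, hNx, fun a ha b hb h1 h2 => hN a ha b hb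
      (h1.mono (inter_subset_inter_left _ (hgV a ha).2.2.1))
      (h2.mono (inter_subset_inter_left _ (hgV b hb).2.2.1))⟩
  have huniq : ∀ a ∈ D, ∀ b ∈ D, ∀ x, x ∈ V a → x ∈ V b → a = b := by
    intro a ha b hb x hxa hxb
    obtain ⟨N, hNx, hN⟩ := hN' x
    exact hN a ha b hb ⟨x, hxa, mem_of_mem_nhds hNx⟩ ⟨x, hxb, mem_of_mem_nhds hNx⟩
  have hglue : ∀ k : X → X → X, ∃ G : X → X,
      (∀ a ∈ D, ∀ x ∈ V a, G x = k a x) ∧ ∀ x, (∀ a ∈ D, x ∉ V a) → G x = x := by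
    intro k
    classical
    refine ⟨fun x => if h : ∃ a ∈ D, x ∈ V a then k h.choose x else x, fun a ha x hx => ?_,
      fun x hx => dif_neg (by push Not; exact hx)⟩
    have h : ∃ a ∈ D, x ∈ V a := ⟨a, ha, hx⟩
    simp only [dif_pos h]
    rw [huniq a ha _ h.choose_spec.1 x hx h.choose_spec.2]
  obtain ⟨G, hG, hG'⟩ := hglue fun a => g a
  obtain ⟨H, hH, hH'⟩ := hglue fun a => (g a).symm
  have hsymm : ∀ a ∈ D, ∀ x ∈ V a, (g a).symm x ∈ V a := by
    intro a ha x hx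
    rw [← (hgV a ha).2.2.2.1]
    simpa using hx
  refine ⟨{ toFun := G, invFun := H, left_inv := fun x => ?_, right_inv := fun x => ?_,
            continuous_toFun := continuous_of_discrete_clopen_family (fun a ha => (hgV a ha).1) hN'
              (fun a _ => (g a).continuous) hG hG'
            continuous_invFun := continuous_of_discrete_clopen_family (fun a ha => (hgV a ha).1) hN'
              (fun a _ => (g a).symm.continuous) hH hH' }, V, g, fun a ha => ?_, hG'⟩
  · by_cases hx : ∃ a ∈ D, x ∈ V a
    · obtain ⟨a, ha, hxa⟩ := hx
      rw [hG a ha x hxa, hH a ha _ (((hgV a ha).2.2.2.1 x).2 hxa), Homeomorph.symm_apply_apply]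
    · push Not at hx
      rw [hG' x hx, hH' x hx]
  · by_cases hx : ∃ a ∈ D, x ∈ V a
    · obtain ⟨a, ha, hxa⟩ := hx
      rw [hH a ha x hxa, hG a ha _ (hsymm a ha x hxa), Homeomorph.apply_symm_apply]
    · push Not at hx
      rw [hH' x hx, hG' x hx]
  · obtain ⟨h1, h2, h3, h4, h5⟩ := hgV a ha
    exact ⟨h1, h2, h3.trans (hW a ha).2.2, h4, h5, hG a ha⟩

/-- Eventual constancy supplies the limits and makes them mutually inverse; the summable bounds make
convergence uniform, hence the limits continuous. -/
theorem exists_homeomorph_of_eventually_const {X : Type*} [MetricSpace X] (f : ℕ → (X ≃ₜ X))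
    (h1 : ∀ n x, dist (f (n + 1) x) (f n x) ≤ (1 / 2) ^ n)
    (h2 : ∀ n x, dist ((f (n + 1)).symm x) ((f n).symm x) ≤ (1 / 2) ^ n)
    (h3 : ∀ x, ∃ N, ∀ n ≥ N, f (n + 1) x = f n x)
    (h4 : ∀ x, ∃ N, ∀ n ≥ N, (f (n + 1)).symm x = (f n).symm x) :
    ∃ F : X ≃ₜ X, ∀ x, ∃ N, ∀ n ≥ N, F x = f n x := by
  have key : ∀ g : ℕ → X → X, (∀ n, Continuous (g n)) →
      (∀ n x, dist (g (n + 1) x) (g n x) ≤ (1 / 2) ^ n) →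
      (∀ x, ∃ N, ∀ n ≥ N, g (n + 1) x = g n x) →
      ∃ G : X → X, Continuous G ∧ ∀ x, ∃ N, ∀ n ≥ N, G x = g n x := by
    intro g hg hd hc
    choose N hN using hc
    have hG : ∀ x, ∀ n ≥ N x, g (N x) x = g n x := by
      intro x n hn
      induction n, hn using Nat.le_induction with
      | base => rfl
      | succ n hn ih => rw [ih, hN x n hn]
    -- The bound is the exact partial geometric sum, so the induction closes.
    have hdist : ∀ n k x, dist (g (n + k) x) (g n x) ≤ 2 * (1 / 2) ^ n - 2 * (1 / 2) ^ (n + k) := by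
      intro n k x
      induction k with
      | zero => simp
      | succ k ih =>
        have := dist_triangle (g (n + (k + 1)) x) (g (n + k) x) (g n x)
        have h := hd (n + k) x
        rw [← add_assoc] at *
        rw [pow_succ (1 / 2 : ℝ) (n + k)]
        linarith
    refine ⟨fun x => g (N x) x, ?_, fun x => ⟨N x, hG x⟩⟩
    have hu : TendstoUniformly g (fun x => g (N x) x) Filter.atTop := by
      rw [Metric.tendstoUniformly_iff]
      intro ε hε
      have ht : Filter.Tendsto (fun n : ℕ => 2 * (1 / 2 : ℝ) ^ n) Filter.atTop (𝓝 (2 * 0)) :=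
        (tendsto_pow_atTop_nhds_zero_of_lt_one (by norm_num) (by norm_num)).const_mul 2
      rw [mul_zero] at ht
      filter_upwards [ht.eventually_lt_const hε] with n hn x
      rw [hG x (n + N x) (Nat.le_add_left _ _)]
      have := hdist n (N x) x
      have hp : (0 : ℝ) < (1 / 2) ^ (n + N x) := by positivity
      linarith
    exact hu.continuous (.of_forall hg)
  obtain ⟨F, hF, hF'⟩ := key (fun n => f n) (fun n => (f n).continuous) h1 h3
  obtain ⟨G, hG, hG'⟩ := key (fun n => (f n).symm) (fun n => (f n).symm.continuous) h2 h4
  refine ⟨⟨⟨F, G, fun x => ?_, fun x => ?_⟩, hF, hG⟩, hF'⟩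
  · obtain ⟨N, hN⟩ := hF' x
    obtain ⟨M, hM⟩ := hG' (F x)
    rw [hM (max N M) (le_max_right _ _), hN (max N M) (le_max_left _ _)]
    exact (f _).symm_apply_apply x
  · obtain ⟨N, hN⟩ := hG' x
    obtain ⟨M, hM⟩ := hF' (G x)
    rw [hM (max N M) (le_max_right _ _), hN (max N M) (le_max_left _ _)]
    exact (f _).apply_symm_apply x

/-! ### Moving points inside clopen sets -/

theorem exists_clopen_shells {X : Type*} [MetricSpace X]
    (hZ : ∀ (a : X) (U : Set X), IsOpen U → a ∈ U → ∃ C, IsClopen C ∧ a ∈ C ∧ C ⊆ U)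
    (hX : ∀ x : X, ¬ IsOpen ({x} : Set X)) (a : X) :
    ∃ P : ℕ → Set X, P 0 = univ ∧ (∀ n, IsClopen (P n) ∧ a ∈ P n ∧ P (n + 1) ⊆ P n ∧
      (P n \ P (n + 1)).Nonempty) ∧ ∀ U ∈ 𝓝 a, ∃ n, P n ⊆ U := by
  have step : ∀ (n : ℕ) (P : {P : Set X // IsClopen P ∧ a ∈ P}),
      ∃ Q : {P : Set X // IsClopen P ∧ a ∈ P}, Q.1 ⊆ P.1 ∧ (P.1 \ Q.1).Nonempty ∧
        Q.1 ⊆ Metric.ball a (1 / (n + 1 : ℝ)) := by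
    rintro n ⟨P, hP, ha⟩
    obtain ⟨y, hyP, hya⟩ : ∃ y ∈ P, y ≠ a := by
      by_contra! h
      refine hX a ?_
      rw [← (Set.eq_singleton_iff_unique_mem.2 ⟨ha, h⟩ : P = {a})]
      exact hP.isOpen
    -- Leaving out `y` keeps the shell non-empty, as needed to make it a copy of `X`.
    obtain ⟨Q, hQ, haQ, hsub⟩ := hZ a (P ∩ {y}ᶜ ∩ Metric.ball a (1 / (n + 1 : ℝ)))
      ((hP.isOpen.inter isOpen_compl_singleton).inter Metric.isOpen_ball)
      ⟨⟨ha, hya.symm⟩, Metric.mem_ball_self Nat.one_div_pos_of_nat⟩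
    exact ⟨⟨Q, hQ, haQ⟩, fun x hx => (hsub hx).1.1, ⟨y, hyP, fun h => (hsub h).1.2 rfl⟩,
      fun x hx => (hsub hx).2⟩
  choose s hs1 hs2 hs3 using step
  let P : ℕ → {P : Set X // IsClopen P ∧ a ∈ P} :=
    fun n => Nat.rec ⟨univ, isClopen_univ, mem_univ a⟩ (fun n P => s n P) n
  refine ⟨fun n => (P n).1, rfl,
    fun n => ⟨(P n).2.1, (P n).2.2, hs1 n (P n), hs2 n (P n)⟩, fun U hU => ?_⟩
  obtain ⟨r, hr, hrU⟩ := Metric.mem_nhds_iff.1 hU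
  obtain ⟨n, hn⟩ := exists_nat_one_div_lt hr
  exact ⟨n + 1, (hs3 n (P n)).trans ((Metric.ball_subset_ball hn.le).trans hrU)⟩

theorem mem_shell_unique {X : Type*} {P : ℕ → Set X} (hP : ∀ n, P (n + 1) ⊆ P n) {m n : ℕ} {x : X}
    (hm : x ∈ P m \ P (m + 1)) (hn : x ∈ P n \ P (n + 1)) : m = n := by
  have hanti : Antitone P := antitone_nat_of_succ_le hP
  by_contra h
  rcases Nat.lt_or_gt_of_ne h with h | h
  · exact hm.2 (hanti h hn.1)
  · exact hn.2 (hanti h hm.1)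

theorem exists_mem_shell {X : Type*} [TopologicalSpace X] [T1Space X] {P : ℕ → Set X} {a x : X}
    (h0 : P 0 = univ) (hP : ∀ U ∈ 𝓝 a, ∃ n, P n ⊆ U) (hx : x ≠ a) :
    ∃ n, x ∈ P n \ P (n + 1) := by
  classical
  have h : ∃ n, x ∉ P n := by
    obtain ⟨n, hn⟩ := hP {x}ᶜ (isOpen_compl_singleton.mem_nhds hx.symm)
    exact ⟨n, fun h => hn h rfl⟩
  obtain ⟨n, hn⟩ : ∃ n, Nat.find h = n + 1 := by
    refine Nat.exists_eq_succ_of_ne_zero fun h' => ?_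
    have := Nat.find_spec h
    rw [h', h0] at this
    exact this (mem_univ x)
  refine ⟨n, not_not.1 (Nat.find_min h (by omega)), ?_⟩
  rw [← hn]
  exact Nat.find_spec h

theorem exists_continuous_glue_shells {X Y : Type*} [TopologicalSpace X] [T1Space X]
    [TopologicalSpace Y] {P : ℕ → Set X} {Q : ℕ → Set Y} {a : X} {b : Y}
    (h0 : P 0 = univ) (hP : ∀ n, IsClopen (P n) ∧ a ∈ P n ∧ P (n + 1) ⊆ P n)
    (hPa : ∀ U ∈ 𝓝 a, ∃ n, P n ⊆ U) (hQ : ∀ n, b ∈ Q n ∧ Q (n + 1) ⊆ Q n)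
    (hQb : ∀ U ∈ 𝓝 b, ∃ n, Q n ⊆ U) (h : ∀ n, ↥(P n \ P (n + 1)) → Y)
    (hc : ∀ n, Continuous (h n)) (hh : ∀ n x, h n x ∈ Q n) :
    ∃ F : X → Y, Continuous F ∧ F a = b ∧ ∀ n (x : ↥(P n \ P (n + 1))), F x = h n x := by
  classical
  have hPanti := antitone_nat_of_succ_le fun n => (hP n).2.2
  have hQanti := antitone_nat_of_succ_le fun n => (hQ n).2
  let F : X → Y := fun x =>
    if hx : ∃ n, x ∈ P n \ P (n + 1) then h hx.choose ⟨x, hx.choose_spec⟩ else b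
  have hFa : F a = b := dif_neg fun ⟨n, hn⟩ => hn.2 (hP (n + 1)).2.1
  have hF : ∀ n (x : ↥(P n \ P (n + 1))), F x = h n x := by
    rintro n ⟨x, hx⟩
    have hex : ∃ n, x ∈ P n \ P (n + 1) := ⟨n, hx⟩
    have heq := mem_shell_unique (fun n => (hP n).2.2) hex.choose_spec hx
    simp only [F, dif_pos hex]
    congr!
  refine ⟨F, ?_, hFa, hF⟩
  rw [continuous_iff_continuousAt]
  intro x
  by_cases hx : x = a
  · subst hx
    intro U hU
    rw [hFa] at hU
    obtain ⟨n, hn⟩ := hQb U hU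
    rw [Filter.mem_map]
    filter_upwards [(hP n).1.isOpen.mem_nhds (hP n).2.1] with y hy
    refine hn ?_
    by_cases hyx : y = x
    · rw [hyx, hFa]; exact (hQ n).1
    · obtain ⟨m, hm⟩ := exists_mem_shell h0 hPa hyx
      rw [hF m ⟨y, hm⟩]
      refine hQanti ?_ (hh m _)
      by_contra hlt
      exact hm.2 (hPanti (by omega) hy)
  · obtain ⟨n, hn⟩ := exists_mem_shell h0 hPa hx
    have hon : ContinuousOn F (P n \ P (n + 1)) := by
      rw [continuousOn_iff_continuous_domRestrict]
      exact (hc n).congr fun y => (hF n y).symm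
    exact hon.continuousAt (((hP n).1.diff (hP (n + 1)).1).isOpen.mem_nhds hn)

/-- The complements of `a` and `b` split into non-empty clopen shells shrinking to these points. All
shells are copies of `X`, so they can be matched one by one. -/
theorem exists_homeomorph_apply_eq {X : Type*} [MetricSpace X]
    (hZ : ∀ (a : X) (U : Set X), IsOpen U → a ∈ U → ∃ C, IsClopen C ∧ a ∈ C ∧ C ⊆ U)
    (hX : ∀ x : X, ¬ IsOpen ({x} : Set X))
    (hh : ∀ C : Set X, IsClopen C → C.Nonempty → Nonempty (C ≃ₜ X)) (a b : X) :
    ∃ g : X ≃ₜ X, g a = b := by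
  obtain ⟨P, hP0, hP, hPa⟩ := exists_clopen_shells hZ hX a
  obtain ⟨Q, hQ0, hQ, hQb⟩ := exists_clopen_shells hZ hX b
  have hex : ∀ n, Nonempty (↥(P n \ P (n + 1)) ≃ₜ ↥(Q n \ Q (n + 1))) := fun n =>
    ⟨(hh _ ((hP n).1.diff (hP (n + 1)).1) (hP n).2.2.2).some.trans
      (hh _ ((hQ n).1.diff (hQ (n + 1)).1) (hQ n).2.2.2).some.symm⟩
  let h := fun n => (hex n).some
  obtain ⟨F, hFc, hFa, hF⟩ := exists_continuous_glue_shells hP0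
    (fun n => ⟨(hP n).1, (hP n).2.1, (hP n).2.2.1⟩) hPa
    (fun n => ⟨(hQ n).2.1, (hQ n).2.2.1⟩) hQb (fun n x => (h n x : X))
    (fun n => continuous_subtype_val.comp (h n).continuous) (fun n x => (h n x).2.1)
  obtain ⟨G, hGc, hGb, hG⟩ := exists_continuous_glue_shells hQ0
    (fun n => ⟨(hQ n).1, (hQ n).2.1, (hQ n).2.2.1⟩) hQb
    (fun n => ⟨(hP n).2.1, (hP n).2.2.1⟩) hPa (fun n x => ((h n).symm x : X))
    (fun n => continuous_subtype_val.comp (h n).symm.continuous) (fun n x => ((h n).symm x).2.1)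
  refine ⟨⟨⟨F, G, fun x => ?_, fun x => ?_⟩, hFc, hGc⟩, hFa⟩
  · by_cases hx : x = a
    · rw [hx, hFa, hGb]
    · obtain ⟨n, hn⟩ := exists_mem_shell hP0 hPa hx
      rw [hF n ⟨x, hn⟩, hG n (h n ⟨x, hn⟩), Homeomorph.symm_apply_apply]
  · by_cases hx : x = b
    · rw [hx, hGb, hFa]
    · obtain ⟨n, hn⟩ := exists_mem_shell hQ0 hQb hx
      rw [hG n ⟨x, hn⟩, hF n ((h n).symm ⟨x, hn⟩), Homeomorph.apply_symm_apply]

theorem IsClopen.exists_homeomorph_extend {X : Type*} [TopologicalSpace X] {V : Set X}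
    (hV : IsClopen V) (e : V ≃ₜ V) : ∃ g : X ≃ₜ X, ∀ x : V, g x = e x := by
  classical
  have key : ∀ e : V ≃ₜ V, ∃ F : X → X, Continuous F ∧ (∀ x : V, F x = e x) ∧
      ∀ x, x ∉ V → F x = x := by
    intro e
    let F : X → X := fun x => if h : x ∈ V then e ⟨x, h⟩ else x
    have h1 : ∀ x : V, F x = e x := fun x => dif_pos x.2
    have h2 : ∀ x, x ∉ V → F x = x := fun x hx => dif_neg hx
    refine ⟨F, ?_, h1, h2⟩
    rw [continuous_iff_continuousAt]
    intro x
    by_cases hx : x ∈ V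
    · have hon : ContinuousOn F V := by
        rw [continuousOn_iff_continuous_domRestrict]
        exact (continuous_subtype_val.comp e.continuous).congr fun y => (h1 y).symm
      exact hon.continuousAt (hV.isOpen.mem_nhds hx)
    · refine continuousAt_id.congr ?_
      filter_upwards [hV.compl.isOpen.mem_nhds hx] with y hy using (h2 y hy).symm
  obtain ⟨F, hFc, hF, hF'⟩ := key e
  obtain ⟨G, hGc, hG, hG'⟩ := key e.symm
  refine ⟨⟨⟨F, G, fun x => ?_, fun x => ?_⟩, hFc, hGc⟩, hF⟩
  · by_cases hx : x ∈ V
    · rw [hF ⟨x, hx⟩, hG, Homeomorph.symm_apply_apply]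
    · rw [hF' x hx, hG' x hx]
  · by_cases hx : x ∈ V
    · rw [hG ⟨x, hx⟩, hF, Homeomorph.apply_symm_apply]
    · rw [hG' x hx, hF' x hx]

/-- Since `V` is a copy of `X`, transitivity of `X` transfers to `V`; the resulting self-map of `V`
extends by the identity. -/
theorem exists_homeomorph_clopen_apply_mem {X : Type*} [MetricSpace X]
    (hZ : ∀ (a : X) (U : Set X), IsOpen U → a ∈ U → ∃ C, IsClopen C ∧ a ∈ C ∧ C ⊆ U)
    (hX : ∀ x : X, ¬ IsOpen ({x} : Set X))
    (hh : ∀ C : Set X, IsClopen C → C.Nonempty → Nonempty (C ≃ₜ X)) {Y : Set X} (hY : Dense Y)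
    {V : Set X} (hV : IsClopen V) {a : X} (ha : a ∈ V) :
    ∃ g : X ≃ₜ X, (∀ x, g x ∈ V ↔ x ∈ V) ∧ g a ∈ Y := by
  obtain ⟨φ⟩ := hh V hV ⟨a, ha⟩
  obtain ⟨b, hbV, hbY⟩ := hY.inter_open_nonempty V hV.isOpen ⟨a, ha⟩
  obtain ⟨k, hk⟩ := exists_homeomorph_apply_eq hZ hX hh (φ ⟨a, ha⟩) (φ ⟨b, hbV⟩)
  obtain ⟨g, hg⟩ := hV.exists_homeomorph_extend (φ.trans (k.trans φ.symm))
  refine ⟨g, fun x => ⟨fun hx => ?_, fun hx => ?_⟩, ?_⟩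
  · have := hg ((φ.trans (k.trans φ.symm)).symm ⟨g x, hx⟩)
    rw [Homeomorph.apply_symm_apply] at this
    rw [← g.injective this]
    exact Subtype.coe_prop _
  · rw [hg ⟨x, hx⟩]
    exact Subtype.coe_prop _
  · rw [hg ⟨a, ha⟩]
    simpa [hk] using hbY

/-! ### Countable families of moves and invariant sets -/

/-- Every point of `S` has arbitrarily small clopen neighbourhoods that are preserved by some
member of `𝒢` which moves the point into `Y`. -/
def LocallyMovesInto {X : Type*} [TopologicalSpace X] (𝒢 : Set (X ≃ₜ X)) (S Y : Set X) : Prop :=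
  ∀ a ∈ S, ∀ U ∈ 𝓝 a, ∃ g ∈ 𝒢, ∃ V, IsClopen V ∧ a ∈ V ∧ V ⊆ U ∧ (∀ x, g x ∈ V ↔ x ∈ V) ∧ g a ∈ Y

/-- One glued homeomorphism serves all points of a closed discrete piece at a given scale, so
countably many suffice. Countability keeps the later closing-off `σ`-discrete. -/
theorem exists_countable_locallyMovesInto {X : Type*} [MetricSpace X]
    (hZ : ∀ (a : X) (U : Set X), IsOpen U → a ∈ U → ∃ C, IsClopen C ∧ a ∈ C ∧ C ⊆ U)
    {S Y : Set X} (hS : IsSigmaDiscrete S)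
    (hY : ∀ V, IsClopen V → ∀ a ∈ V, ∃ g : X ≃ₜ X, (∀ x, g x ∈ V ↔ x ∈ V) ∧ g a ∈ Y) :
    ∃ 𝒢 : Set (X ≃ₜ X), 𝒢.Countable ∧ LocallyMovesInto 𝒢 S Y := by
  obtain ⟨D, hD, rfl⟩ := isSigmaDiscrete_iff.1 hS
  have h := fun n m : ℕ => exists_homeomorph_glue (hD n)
    (fun a => Metric.ball a (1 / (m + 1 : ℝ)))
    (fun a _ => Metric.ball_mem_nhds a Nat.one_div_pos_of_nat) (fun a g => g a ∈ Y)
    (fun a _ O hO haO => by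
      obtain ⟨V, hV, haV, hVO⟩ := hZ a O hO haO
      obtain ⟨g, hg, hga⟩ := hY V hV a haV
      exact ⟨g, V, hV, haV, hVO, hg, hga⟩)
  choose G V g hG _ using h
  refine ⟨range fun p : ℕ × ℕ => G p.1 p.2, countable_range _, fun a ha U hU => ?_⟩
  obtain ⟨n, hn⟩ := mem_iUnion.1 ha
  obtain ⟨r, hr, hrU⟩ := Metric.mem_nhds_iff.1 hU
  obtain ⟨m, hm⟩ := exists_nat_one_div_lt hr
  obtain ⟨h1, h2, h3, h4, h5, h6⟩ := hG n m a hn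
  refine ⟨_, ⟨(n, m), rfl⟩, V n m a, h1, h2,
    h3.trans ((Metric.ball_subset_ball hm.le).trans hrU), fun x => ⟨fun hx => ?_, fun hx => ?_⟩, ?_⟩
  · have hy : (g n m a).symm (G n m x) ∈ V n m a := by
      rw [← h4, Homeomorph.apply_symm_apply]
      exact hx
    have := h6 _ hy
    rw [Homeomorph.apply_symm_apply] at this
    rwa [← (G n m).injective this]
  · change G n m x ∈ _
    rw [h6 x hx]
    exact (h4 x).2 hx
  · change G n m a ∈ _
    rw [h6 a h2]
    exact h5

theorem LocallyMovesInto.mono {X : Type*} [TopologicalSpace X] {𝒢 ℋ : Set (X ≃ₜ X)} {S Y : Set X}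
    (h : LocallyMovesInto 𝒢 S Y) (hle : 𝒢 ⊆ ℋ) : LocallyMovesInto ℋ S Y := fun a ha U hU =>
  let ⟨g, hg, H⟩ := h a ha U hU
  ⟨g, hle hg, H⟩

/-- New points need new moves and new moves create new points; alternating `ω` times closes both
off. -/
theorem exists_invariant_isSigmaDiscrete {X : Type*} [TopologicalSpace X] {𝒴 : Set (Set X)}
    (hloc : ∀ S : Set X, IsSigmaDiscrete S →
      ∃ 𝒢 : Set (X ≃ₜ X), 𝒢.Countable ∧ ∀ Y ∈ 𝒴, LocallyMovesInto 𝒢 S Y)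
    {S₀ : Set X} (hS₀ : IsSigmaDiscrete S₀) :
    ∃ (S : Set X) (𝒢 : Set (X ≃ₜ X)), IsSigmaDiscrete S ∧ S₀ ⊆ S ∧
      (∀ g ∈ 𝒢, ∀ x, g x ∈ S ↔ x ∈ S) ∧ ∀ Y ∈ 𝒴, LocallyMovesInto 𝒢 S Y := by
  have step : ∀ p : {p : Set X × Set (X ≃ₜ X) // IsSigmaDiscrete p.1 ∧ p.2.Countable},
      ∃ q : {p : Set X × Set (X ≃ₜ X) // IsSigmaDiscrete p.1 ∧ p.2.Countable},
        p.1.1 ⊆ q.1.1 ∧ p.1.2 ⊆ q.1.2 ∧ (∀ Y ∈ 𝒴, LocallyMovesInto q.1.2 p.1.1 Y) ∧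
        ∀ g ∈ q.1.2, ∀ x ∈ p.1.1, g x ∈ q.1.1 ∧ g.symm x ∈ q.1.1 := by
    rintro ⟨⟨S, 𝒢⟩, hS, h𝒢⟩
    obtain ⟨ℋ, hℋ, hmov⟩ := hloc S hS
    have hc : (𝒢 ∪ ℋ).Countable := h𝒢.union hℋ
    refine ⟨⟨⟨S ∪ ⋃ g ∈ 𝒢 ∪ ℋ, (g '' S ∪ g.symm '' S), 𝒢 ∪ ℋ⟩,
      hS.union (.biUnion hc fun g _ => (hS.image g).union (hS.image g.symm)), hc⟩,
      subset_union_left, subset_union_left, fun Y hY => (hmov Y hY).mono subset_union_right,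
      fun g hg x hx => ⟨Or.inr ?_, Or.inr ?_⟩⟩
    · exact mem_biUnion hg (Or.inl (mem_image_of_mem _ hx))
    · exact mem_biUnion hg (Or.inr (mem_image_of_mem _ hx))
  choose s hs1 hs2 hs3 hs4 using step
  let p : ℕ → {p : Set X × Set (X ≃ₜ X) // IsSigmaDiscrete p.1 ∧ p.2.Countable} :=
    fun n => Nat.rec ⟨(S₀, ∅), hS₀, countable_empty⟩ (fun _ q => s q) n
  have hmS : Monotone fun n => (p n).1.1 := monotone_nat_of_le_succ fun n => hs1 (p n)
  have hmG : Monotone fun n => (p n).1.2 := monotone_nat_of_le_succ fun n => hs2 (p n)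
  have hinv : ∀ g ∈ ⋃ n, (p n).1.2, ∀ x ∈ ⋃ n, (p n).1.1,
      g x ∈ ⋃ n, (p n).1.1 ∧ g.symm x ∈ ⋃ n, (p n).1.1 := by
    intro g hg x hx
    obtain ⟨n, hn⟩ := mem_iUnion.1 hg
    obtain ⟨m, hm⟩ := mem_iUnion.1 hx
    have := hs4 (p (max n m)) g (hmG (by omega : n ≤ max n m + 1) hn) x (hmS (le_max_right n m) hm)
    exact ⟨mem_iUnion.2 ⟨max n m + 1, this.1⟩, mem_iUnion.2 ⟨max n m + 1, this.2⟩⟩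
  refine ⟨⋃ n, (p n).1.1, ⋃ n, (p n).1.2, .iUnion fun n => (p n).2.1,
    subset_iUnion (fun n => (p n).1.1) 0, fun g hg x => ⟨fun hx => ?_, fun hx => (hinv g hg x hx).1⟩,
    fun Y hY a ha => ?_⟩
  · have := (hinv g hg _ hx).2
    rwa [Homeomorph.symm_apply_apply] at this
  · obtain ⟨n, hn⟩ := mem_iUnion.1 ha
    exact (hs3 (p n) Y hY).mono (subset_iUnion (fun n => (p n).1.2) (n + 1)) a hn

/-! ### Back-and-forth between `A` and `B` -/

theorem exists_homeomorph_extend_matching {X : Type*} [MetricSpace X] {S A B E D K : Set X}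
    {𝒢 : Set (X ≃ₜ X)} (h𝒢 : ∀ g ∈ 𝒢, ∀ x, g x ∈ S ↔ x ∈ S) (hB : LocallyMovesInto 𝒢 S B)
    (hB' : LocallyMovesInto 𝒢 S Bᶜ) (f : X ≃ₜ X) (hf : ∀ x, f x ∈ S ↔ x ∈ S)
    (hE : Eᶜ ∈ codiscrete X) (hD : Dᶜ ∈ codiscrete X) (hDS : D ⊆ S)
    (hEm : ∀ x ∈ E, x ∈ A ↔ f x ∈ B) (hK : IsClosed K) (hKS : ∀ x ∈ K, x ∉ S) {ε : ℝ}
    (hε : 0 < ε) :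
    ∃ f' : X ≃ₜ X, (∀ x, f' x ∈ S ↔ x ∈ S) ∧ (∀ x ∈ E, f' x = f x) ∧
      (∀ x ∈ E ∪ D, x ∈ A ↔ f' x ∈ B) ∧ (∀ x ∈ K, f' x = f x) ∧ (∀ x, f x ∈ K → f' x = f x) ∧
      (∀ x, dist (f' x) (f x) ≤ ε) ∧ ∀ y, dist (f'.symm y) (f.symm y) ≤ ε := by
  let D' := f '' (D \ E)
  have hD' : D'ᶜ ∈ codiscrete X :=
    f.compl_image_mem_codiscrete (compl_mem_codiscrete_of_subset hD sdiff_subset)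
  have hEc : IsClosed (f '' E) := f.isClosedMap _ (compl_mem_codiscrete_iff.1 hE).1
  have hKc : IsClosed (f '' K) := f.isClosedMap _ hK
  -- Avoiding `f '' E` keeps old matches, avoiding `f '' K` freezes `f` on `K`, and avoiding `K`
  -- freezes `f.symm` there. The two balls control `f` and `f.symm`.
  let U : X → Set X := fun a => ((f '' E)ᶜ ∩ Kᶜ ∩ (f '' K)ᶜ) ∩
    (Metric.ball a (ε / 2) ∩ f.symm ⁻¹' Metric.ball (f.symm a) (ε / 2))
  have hD'S : ∀ a ∈ D', a ∈ S := by
    rintro _ ⟨x, hx, rfl⟩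
    exact (hf x).2 (hDS hx.1)
  have hU : ∀ a ∈ D', U a ∈ 𝓝 a := by
    intro a ha
    have haS := hD'S a ha
    refine Filter.inter_mem (((hEc.isOpen_compl.inter hK.isOpen_compl).inter
      hKc.isOpen_compl).mem_nhds ⟨⟨?_, fun h => hKS a h haS⟩, ?_⟩) (Filter.inter_mem
      (Metric.ball_mem_nhds a (half_pos hε)) (f.symm.continuous.continuousAt.preimage_mem_nhds
        (Metric.ball_mem_nhds _ (half_pos hε))))
    · obtain ⟨x, hx, rfl⟩ := ha
      rintro ⟨y, hy, hyx⟩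
      exact hx.2 (f.injective hyx ▸ hy)
    · rintro ⟨y, hy, rfl⟩
      exact hKS y hy ((hf y).1 haS)
  obtain ⟨G, V, g, hG, hG'⟩ := exists_homeomorph_glue hD' U hU
    (fun a g => g ∈ 𝒢 ∧ (f.symm a ∈ A ↔ g a ∈ B)) (fun a ha O hO haO => by
      by_cases haA : f.symm a ∈ A
      · obtain ⟨g, hg, V, h1, h2, h3, h4, h5⟩ := hB a (hD'S a ha) O (hO.mem_nhds haO)
        exact ⟨g, V, h1, h2, h3, h4, hg, iff_of_true haA h5⟩
      · obtain ⟨g, hg, V, h1, h2, h3, h4, h5⟩ := hB' a (hD'S a ha) O (hO.mem_nhds haO)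
        exact ⟨g, V, h1, h2, h3, h4, hg, iff_of_false haA h5⟩)
  have hGU : ∀ x, G x = x ∨ ∃ a ∈ D', x ∈ U a ∧ G x ∈ U a := by
    intro x
    by_cases hx : ∃ a ∈ D', x ∈ V a
    · obtain ⟨a, ha, hxa⟩ := hx
      obtain ⟨-, -, h3, h4, -, h6⟩ := hG a ha
      exact Or.inr ⟨a, ha, h3 hxa, h3 (by rw [h6 x hxa]; exact (h4 x).2 hxa)⟩
    · push Not at hx
      exact Or.inl (hG' x hx)
  have hGS : ∀ x, G x ∈ S ↔ x ∈ S := by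
    intro x
    by_cases hx : ∃ a ∈ D', x ∈ V a
    · obtain ⟨a, ha, hxa⟩ := hx
      obtain ⟨-, -, -, -, h5, h6⟩ := hG a ha
      rw [h6 x hxa]
      exact h𝒢 _ h5.1 x
    · push Not at hx
      rw [hG' x hx]
  have hGE : ∀ x ∈ E, G (f x) = f x := fun x hx =>
    (hGU (f x)).resolve_right fun ⟨a, _, h, _⟩ => h.1.1.1 (mem_image_of_mem f hx)
  refine ⟨f.trans G, fun x => (hGS _).trans (hf x), hGE, fun x hx => ?_, fun x hx => ?_,
    fun x hx => ?_, fun x => ?_, fun y => ?_⟩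
  · by_cases hxE : x ∈ E
    · rw [Homeomorph.trans_apply, hGE x hxE]
      exact hEm x hxE
    · obtain ⟨-, h2, -, -, h5, h6⟩ := hG (f x) ⟨x, ⟨hx.resolve_left hxE, hxE⟩, rfl⟩
      rw [Homeomorph.trans_apply, h6 _ h2]
      simpa using h5.2
  · exact (hGU (f x)).resolve_right fun ⟨a, _, h, _⟩ => h.1.2 (mem_image_of_mem f hx)
  · exact (hGU (f x)).resolve_right fun ⟨a, _, h, _⟩ => h.1.1.2 hx
  · rw [Homeomorph.trans_apply]
    rcases hGU (f x) with h | ⟨a, -, h1, h2⟩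
    · rw [h, dist_self]; exact hε.le
    · have h1 := Metric.mem_ball.1 h1.2.1
      have h2 := Metric.mem_ball.1 h2.2.1
      linarith [dist_triangle_right (G (f x)) (f x) a]
  · change dist (f.symm (G.symm y)) _ ≤ ε
    obtain ⟨z, rfl⟩ := G.surjective y
    rw [Homeomorph.symm_apply_apply]
    rcases hGU z with h | ⟨a, -, h1, h2⟩
    · rw [h, dist_self]; exact hε.le
    · have h1 := Metric.mem_ball.1 h1.2.2
      have h2 := Metric.mem_ball.1 h2.2.2
      linarith [dist_triangle_right (f.symm z) (f.symm (G z)) (f.symm a)]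

/-- The one-sided extension is applied to `f`, then to the inverse of the result with `A` and `B`
exchanged, each with half the error. -/
theorem exists_homeomorph_extend_matching_both {X : Type*} [MetricSpace X] {S A B E D K : Set X}
    {𝒢 : Set (X ≃ₜ X)} (h𝒢 : ∀ g ∈ 𝒢, ∀ x, g x ∈ S ↔ x ∈ S)
    (hA : LocallyMovesInto 𝒢 S A) (hA' : LocallyMovesInto 𝒢 S Aᶜ)
    (hB : LocallyMovesInto 𝒢 S B) (hB' : LocallyMovesInto 𝒢 S Bᶜ)
    (f : X ≃ₜ X) (hf : ∀ x, f x ∈ S ↔ x ∈ S)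
    (hE : Eᶜ ∈ codiscrete X) (hD : Dᶜ ∈ codiscrete X) (hDS : D ⊆ S)
    (hEm : ∀ x ∈ E, x ∈ A ↔ f x ∈ B) (hK : IsClosed K) (hKS : ∀ x ∈ K, x ∉ S) {ε : ℝ}
    (hε : 0 < ε) :
    ∃ (f' : X ≃ₜ X) (E' : Set X), (∀ x, f' x ∈ S ↔ x ∈ S) ∧ E'ᶜ ∈ codiscrete X ∧
      (∀ x ∈ E', x ∈ A ↔ f' x ∈ B) ∧ E ⊆ E' ∧ D ⊆ E' ∧ (∀ y ∈ D, f'.symm y ∈ E') ∧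
      (∀ x ∈ E, f' x = f x) ∧ (∀ x ∈ K, f' x = f x) ∧ (∀ x, f x ∈ K → f' x = f x) ∧
      (∀ x, dist (f' x) (f x) ≤ ε) ∧ ∀ y, dist (f'.symm y) (f.symm y) ≤ ε := by
  obtain ⟨f₁, a1, a2, a3, a4, a5, a6, a7⟩ := exists_homeomorph_extend_matching h𝒢 hB hB' f hf hE hD
    hDS hEm hK hKS (half_pos hε)
  obtain ⟨f₂, b1, b2, b3, b4, b5, b6, b7⟩ := exists_homeomorph_extend_matching (A := B) h𝒢 hA hA'
    f₁.symm (fun x => by simpa using (a1 (f₁.symm x)).symm)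
    (f₁.compl_image_mem_codiscrete (compl_union_mem_codiscrete hE hD)) hD hDS
    (by rintro _ ⟨x, hx, rfl⟩; simpa using (a3 x hx).symm) hK hKS (half_pos hε)
  have c2 : ∀ x ∈ E ∪ D, f₂.symm x = f₁ x := fun x hx => by
    rw [Homeomorph.symm_apply_eq, b2 _ (mem_image_of_mem f₁ hx), Homeomorph.symm_apply_apply]
  refine ⟨f₂.symm, E ∪ D ∪ f₂ '' D, fun x => by simpa using (b1 (f₂.symm x)).symm,
    compl_union_mem_codiscrete (compl_union_mem_codiscrete hE hD) (f₂.compl_image_mem_codiscrete hD),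
    ?_, fun x hx => Or.inl (Or.inl hx), fun x hx => Or.inl (Or.inr hx),
    fun y hy => Or.inr (mem_image_of_mem f₂ hy), fun x hx => ?_, fun x hx => ?_, fun x hx => ?_,
    fun x => ?_, fun y => ?_⟩
  · rintro x (hx | ⟨y, hy, rfl⟩)
    · rw [c2 x hx]
      exact a3 x hx
    · rw [Homeomorph.symm_apply_apply]
      exact (b3 y (Or.inr hy)).symm
  · rw [c2 x (Or.inl hx), a2 x hx]
  · rw [← a4 x hx, Homeomorph.symm_apply_eq, b5 _ (by simpa using hx), Homeomorph.symm_apply_apply]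
  · rw [← a5 x hx, Homeomorph.symm_apply_eq, b4 _ (by rwa [a5 x hx]), Homeomorph.symm_apply_apply]
  · have := b7 x
    rw [Homeomorph.symm_symm] at this
    linarith [dist_triangle (f₂.symm x) (f₁ x) (f x), a6 x]
  · change dist (f₂ y) _ ≤ ε
    linarith [dist_triangle (f₂ y) (f₁.symm y) (f.symm y), a7 y, b6 y]

theorem exists_homeomorph_image_eq_of_locallyMovesInto {X : Type*} [MetricSpace X] {S A B : Set X}
    {𝒢 : Set (X ≃ₜ X)} (h𝒢 : ∀ g ∈ 𝒢, ∀ x, g x ∈ S ↔ x ∈ S)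
    (hA : LocallyMovesInto 𝒢 S A) (hA' : LocallyMovesInto 𝒢 S Aᶜ)
    (hB : LocallyMovesInto 𝒢 S B) (hB' : LocallyMovesInto 𝒢 S Bᶜ)
    (hS : IsSigmaDiscrete S) (hSG : IsGδ S) (hAS : A ⊆ S) (hBS : B ⊆ S) :
    ∃ f : X ≃ₜ X, f '' A = B := by
  obtain ⟨D, hD, hSD⟩ := isSigmaDiscrete_iff.1 hS
  obtain ⟨O, hO, hSO⟩ := hSG.eq_iInter_nat
  let L : ℕ → Set X := fun n => ⋃ i ∈ Iic n, (O i)ᶜ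
  have hL : ∀ n, IsClosed (L n) := fun n =>
    (finite_Iic n).isClosed_biUnion fun i _ => (hO i).isClosed_compl
  have hLS : ∀ n, ∀ x ∈ L n, x ∉ S := by
    intro n x hx hxS
    simp only [L, mem_iUnion] at hx
    obtain ⟨i, -, hi⟩ := hx
    rw [hSO] at hxS
    exact hi (mem_iInter.1 hxS i)
  have hLx : ∀ x ∉ S, ∃ k, ∀ n ≥ k, x ∈ L n := by
    intro x hx
    rw [hSO, mem_iInter] at hx
    push Not at hx
    obtain ⟨k, hk⟩ := hx
    exact ⟨k, fun n hn => mem_biUnion (mem_Iic.2 hn) hk⟩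
  let T := {p : (X ≃ₜ X) × Set X // (∀ x, p.1 x ∈ S ↔ x ∈ S) ∧ p.2ᶜ ∈ codiscrete X ∧
    ∀ x ∈ p.2, x ∈ A ↔ p.1 x ∈ B}
  have step : ∀ (n : ℕ) (p : T), ∃ q : T, p.1.2 ⊆ q.1.2 ∧ D n ⊆ q.1.2 ∧
      (∀ y ∈ D n, q.1.1.symm y ∈ q.1.2) ∧ (∀ x ∈ p.1.2, q.1.1 x = p.1.1 x) ∧
      (∀ x ∈ L n, q.1.1 x = p.1.1 x) ∧ (∀ x, p.1.1 x ∈ L n → q.1.1 x = p.1.1 x) ∧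
      (∀ x, dist (q.1.1 x) (p.1.1 x) ≤ (1 / 2) ^ n) ∧
      ∀ y, dist (q.1.1.symm y) (p.1.1.symm y) ≤ (1 / 2) ^ n := by
    rintro n ⟨⟨f, E⟩, hf, hE, hEm⟩
    obtain ⟨f', E', h1, h2, h3, H⟩ := exists_homeomorph_extend_matching_both h𝒢 hA hA' hB hB' f hf
      hE (hD n) (hSD ▸ subset_iUnion D n) hEm (hL n) (hLS n) (ε := (1 / 2) ^ n) (by positivity)
    exact ⟨⟨(f', E'), h1, h2, h3⟩, H⟩
  choose s s1 s2 s3 s4 s5 s6 s7 s8 using step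
  let p : ℕ → T := fun n => Nat.rec ⟨(.refl X, ∅), fun _ => Iff.rfl, by simp, by simp⟩
    (fun n q => s n q) n
  have hmono : Monotone fun n => (p n).1.2 := monotone_nat_of_le_succ fun n => s1 n (p n)
  have hconst : ∀ m, ∀ x ∈ (p m).1.2, ∀ n ≥ m, (p n).1.1 x = (p m).1.1 x := by
    intro m x hx n hn
    induction n, hn using Nat.le_induction with
    | base => rfl
    | succ n hn ih => rw [← ih]; exact s4 n (p n) x (hmono hn hx)
  obtain ⟨F, hF⟩ := exists_homeomorph_of_eventually_const (fun n => (p n).1.1)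
    -- Points of `S` stop moving once their piece `D k` is matched; other points stop once they
    -- enter `L k`. The same dichotomy handles the inverses.
    (fun n x => s7 n (p n) x) (fun n y => s8 n (p n) y) (fun x => by
      by_cases hx : x ∈ S
      · rw [hSD, mem_iUnion] at hx
        obtain ⟨k, hk⟩ := hx
        exact ⟨k + 1, fun n hn => s4 n (p n) x (hmono hn (s2 k (p k) hk))⟩
      · obtain ⟨k, hk⟩ := hLx x hx
        exact ⟨k, fun n hn => s5 n (p n) x (hk n hn)⟩) (fun y => by
      by_cases hy : y ∈ S
      · rw [hSD, mem_iUnion] at hy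
        obtain ⟨k, hk⟩ := hy
        have h := hconst (k + 1) _ (s3 k (p k) y hk)
        have h' : ∀ n ≥ k + 1, (p n).1.1.symm y = (p (k + 1)).1.1.symm y := fun n hn => by
          rw [Homeomorph.symm_apply_eq]
          exact ((h n hn).trans ((p (k + 1)).1.1.apply_symm_apply y)).symm
        exact ⟨k + 1, fun n hn => (h' (n + 1) (by omega)).trans (h' n hn).symm⟩
      · obtain ⟨k, hk⟩ := hLx y hy
        refine ⟨k, fun n hn => ?_⟩
        rw [Homeomorph.symm_apply_eq]
        have := s6 n (p n) ((p n).1.1.symm y) (by simpa using hk n hn)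
        rw [Homeomorph.apply_symm_apply] at this
        exact this.symm)
  have hmatch : ∀ x, x ∈ A ↔ F x ∈ B := by
    intro x
    obtain ⟨N, hN⟩ := hF x
    by_cases hx : x ∈ S
    · rw [hSD, mem_iUnion] at hx
      obtain ⟨k, hk⟩ := hx
      rw [hN (max N (k + 1)) (le_max_left _ _)]
      exact (p _).2.2.2 x (hmono (le_max_right _ _) (s2 k (p k) hk))
    · refine iff_of_false (fun h => hx (hAS h)) fun h => hx ?_
      have := hBS h
      rw [hN N le_rfl] at this
      exact ((p N).2.1 x).1 this
  refine ⟨F, Subset.antisymm ?_ fun y hy => ⟨F.symm y, (hmatch _).2 (by simpa using hy), by simp⟩⟩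
  rintro _ ⟨x, hx, rfl⟩
  exact (hmatch x).1 hx

/-! ### Density of complements and conclusion -/

theorem IsSigmaDiscrete.preimage_val {X : Type*} [TopologicalSpace X] {A : Set X}
    (hA : IsSigmaDiscrete A) (C : Set X) : IsSigmaDiscrete ((↑) ⁻¹' A : Set C) := by
  obtain ⟨D, hD, rfl⟩ := hA
  exact ⟨fun n => (↑) ⁻¹' D n, fun n => ⟨(hD n).1.preimage continuous_subtype_val,
    (hD n).2.preimage continuous_subtype_val.continuousOn Subtype.val_injective⟩, preimage_iUnion⟩

/-- A `σ`-discrete set with interior would contain a clopen copy of `X`, making `X` itself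
`σ`-discrete. -/
theorem IsSigmaDiscrete.dense_compl {X : Type*} [TopologicalSpace X]
    (hZ : ∀ (a : X) (U : Set X), IsOpen U → a ∈ U → ∃ C, IsClopen C ∧ a ∈ C ∧ C ⊆ U)
    (hh : ∀ C : Set X, IsClopen C → C.Nonempty → Nonempty (C ≃ₜ X))
    (hX : ¬ IsSigmaDiscrete (univ : Set X)) {A : Set X} (hA : IsSigmaDiscrete A) : Dense Aᶜ := by
  rw [← interior_eq_empty_iff_dense_compl, eq_empty_iff_forall_notMem]
  intro a ha
  obtain ⟨C, hC, haC, hsub⟩ := hZ a _ isOpen_interior ha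
  obtain ⟨φ⟩ := hh C hC ⟨a, haC⟩
  refine hX ?_
  have := (hA.preimage_val C).image φ
  have huniv : ((↑) ⁻¹' A : Set C) = univ := eq_univ_of_forall fun x =>
    (interior_subset (hsub x.2) : (x : X) ∈ A)
  rwa [huniv, image_univ, φ.surjective.range_eq] at this

theorem theorem4 {X : Type*} [TopologicalSpace X] [TopologicalSpace.MetrizableSpace X]
    (hh : IsHHomogeneous X) (hL : IsLambdaSet X)
    (hX : ¬ (IsSigmaDiscrete (Set.univ : Set X) ∧ ∀ x : X, ¬ IsOpen ({x} : Set X))) :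
    IsDenselyHomogeneous X := by
  let := TopologicalSpace.metrizableSpaceMetric X
  obtain ⟨⟨hne, hInd⟩, hh⟩ := hh
  have hZ : ∀ (a : X) (U : Set X), IsOpen U → a ∈ U → ∃ C, IsClopen C ∧ a ∈ C ∧ C ⊆ U := by
    intro a U hU ha
    obtain ⟨C, hC, h1, h2⟩ := hInd {a} U isClosed_singleton hU (singleton_subset_iff.2 ha)
    exact ⟨C, hC, h1 rfl, h2⟩
  refine ⟨exists_isSigmaDiscrete_dense X, fun A B hA hAd hB hBd => ?_⟩
  -- An isolated point is a clopen singleton, hence homeomorphic to `X`; both dense sets are then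
  -- all of `X`.
  by_cases hiso : ∃ x : X, IsOpen ({x} : Set X)
  · obtain ⟨x, hx⟩ := hiso
    obtain ⟨φ⟩ := hh {x} ⟨isClosed_singleton, hx⟩ (singleton_nonempty x)
    have : Subsingleton X := φ.symm.injective.subsingleton
    refine ⟨.refl X, ?_⟩
    rw [Subsingleton.eq_univ_of_nonempty hAd.nonempty, Subsingleton.eq_univ_of_nonempty hBd.nonempty]
    simp
  · push Not at hiso
    have hσ : ¬ IsSigmaDiscrete (univ : Set X) := fun h => hX ⟨h, hiso⟩
    have hloc : ∀ Y : Set X, Dense Y → ∀ S : Set X, IsSigmaDiscrete S →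
        ∃ 𝒢 : Set (X ≃ₜ X), 𝒢.Countable ∧ LocallyMovesInto 𝒢 S Y := fun Y hY S hS =>
      exists_countable_locallyMovesInto hZ hS fun V hV a ha =>
        exists_homeomorph_clopen_apply_mem hZ hiso hh hY hV ha
    have h𝒴 : ∀ Y ∈ ({A, Aᶜ, B, Bᶜ} : Set (Set X)), Dense Y := by
      rintro _ (rfl | rfl | rfl | rfl)
      exacts [hAd, hA.dense_compl hZ hh hσ, hBd, hB.dense_compl hZ hh hσ]
    obtain ⟨S, 𝒢, hS, hABS, hinv, hmov⟩ := exists_invariant_isSigmaDiscrete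
      (𝒴 := {A, Aᶜ, B, Bᶜ}) (fun S hS => by
        have : ∀ Y : Set X, ∃ 𝒢 : Set (X ≃ₜ X), 𝒢.Countable ∧
            (Y ∈ ({A, Aᶜ, B, Bᶜ} : Set (Set X)) → LocallyMovesInto 𝒢 S Y) := fun Y => by
          by_cases hY : Y ∈ ({A, Aᶜ, B, Bᶜ} : Set (Set X))
          · obtain ⟨𝒢, h1, h2⟩ := hloc Y (h𝒴 Y hY) S hS
            exact ⟨𝒢, h1, fun _ => h2⟩
          · exact ⟨∅, countable_empty, fun h => absurd h hY⟩
        choose 𝒢 h1 h2 using this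
        exact ⟨⋃ Y ∈ ({A, Aᶜ, B, Bᶜ} : Set (Set X)), 𝒢 Y,
          (toFinite _).countable.biUnion fun Y _ => h1 Y,
          fun Y hY => (h2 Y hY).mono (subset_biUnion_of_mem (u := 𝒢) hY)⟩) (hA.union hB)
    exact exists_homeomorph_image_eq_of_locallyMovesInto hinv (hmov A (by simp)) (hmov Aᶜ (by simp))
      (hmov B (by simp)) (hmov Bᶜ (by simp)) hS (hL S hS) (subset_union_left.trans hABS)
      (subset_union_right.trans hABS)
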